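/- Fix $\mu>0$. For $N\ge 1$ and $0<p<1$, let $X_{nt}$ ($1\le n\le N$, $t\ge 1$) be real observations from $N$ data streams. For $1\le \nu\le\infty$, let $P_\nu$ (with expectation $E_\nu$) be the probability law under which the streams are independent and each stream, independently of the others, is affected with probability $p$; the observations of an unaffected stream are i.i.d. $N(0,1)$, and those of an affected stream are independent, $N(0,1)$ at times $t<\nu$ and $N(\mu,1)$ at times $t\ge\nu$ (under $P_\infty$ there is no change). A stopping rule $T$ is a stopping time, with values in $\{1,2,\dots\}\cup\{\infty\}$, with respect to the filtration generated by the observations. Let $$\mathrm{ARL}(T)=E_\infty T,\qquad D_N(T)=\sup_{1\le\nu<\infty}E_\nu(T-\nu+1\mid T\ge\nu),$$ where the supremum is over those $\nu$ for which the event $\{T\ge\nu\}$ has positive probability. For $0<\zeta<1$ and $\frac{1-\zeta}{2}<\beta<1-\zeta$ let $$\rho(\beta,\zeta)=\begin{cases}\beta-\frac{1-\zeta}{2} & \text{if } \frac{1-\zeta}{2}<\beta\le\frac{3(1-\zeta)}{4},\\[2pt] \bigl(\sqrt{1-\zeta}-\sqrt{1-\zeta-\beta}\bigr)^2 & \text{if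 } \frac{3(1-\zeta)}{4}<\beta<1-\zeta.\end{cases}$$ **Theorem.** Let $0<\zeta<1$ and $0<\beta<1$. Let $p=p_N\in(0,1)$ and $\gamma=\gamma_N\ge 1$ satisfy $p\sim N^{-\beta}$ and $\log\gamma\sim N^{\zeta}$ as $N\to\infty$, and for each $N\ge1$ let $T=T_N$ be a stopping rule for the $N$ streams with $\mathrm{ARL}(T)\ge\gamma$. (a) If $\frac{1-\zeta}{2}<\beta<1-\zeta$, then $$\liminf_{N\to\infty}\frac{D_N(T)}{\log N}\ge 2\mu^{-2}\rho(\beta,\zeta).$$ (b) If $\beta>1-\zeta$, then $$\liminf_{N\to\infty}\frac{\log D_N(T)}{\log N}\ge\beta+\zeta-1.$$ -/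

import Mathlib

open MeasureTheory ProbabilityTheory Filter Asymptotics
open scoped ENNReal

namespace MultiStream

/-- Data of `N` streams observed at times `1, 2, 3, …`. The entry `ω n i` is the observation
`X_{n,t}` of stream `n` at time `t = i + 1`. -/
abbrev Sample (N : ℕ) : Type := Fin N → ℕ → ℝ

/-- The information available at time `t`: the σ-algebra generated by the observations
`X_{n,1}, …, X_{n,t}` of all streams, that is by the entries `ω n i` with `i < t`.
It is trivial at time `0`, so a stopping time is either identically `0` or always at least `1`. -/
def observed (N : ℕ) :
    Filtration ℕ (inferInstance : MeasurableSpace (Sample N)) where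
  seq t := MeasurableSpace.comap
    (fun (ω : Sample N) (n : Fin N) (i : Fin t) => ω n (i : ℕ)) inferInstance
  mono' := by
    intro s t hst
    rintro A ⟨B, hB, rfl⟩
    refine ⟨(fun (x : Fin N → Fin t → ℝ) (n : Fin N) (i : Fin s) => x n (Fin.castLE hst i)) ⁻¹' B,
      ?_, rfl⟩
    exact (measurable_pi_lambda _ fun n => measurable_pi_lambda _ fun i =>
      (measurable_pi_apply (Fin.castLE hst i)).comp (measurable_pi_apply n)) hB
  le' := by
    intro t
    exact Measurable.comap_le (measurable_pi_lambda _ fun n => measurable_pi_lambda _ fun i =>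
      (measurable_pi_apply (i : ℕ)).comp (measurable_pi_apply n))

/-- Law of a single stream that undergoes the mean shift `μ` at time `ν`: independent
observations, `X_t ∼ N(0, 1)` for `t < ν` and `X_t ∼ N(μ, 1)` for `t ≥ ν`.
For `ν = ⊤` there is no change. -/
noncomputable def shiftedStreamLaw (μ : ℝ) (ν : ℕ∞) : Measure (ℕ → ℝ) :=
  Measure.infinitePi fun i : ℕ =>
    gaussianReal (if ν ≤ ((i + 1 : ℕ) : ℕ∞) then μ else 0) 1

/-- Law of a single stream without change: independent `N(0, 1)` observations. -/
noncomputable def nullStreamLaw : Measure (ℕ → ℝ) :=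
  Measure.infinitePi fun _ : ℕ => gaussianReal 0 1

/-- Law of a single stream when it belongs to the set of affected streams with probability `p`. -/
noncomputable def streamLaw (μ p : ℝ) (ν : ℕ∞) : Measure (ℕ → ℝ) :=
  ENNReal.ofReal (1 - p) • nullStreamLaw + ENNReal.ofReal p • shiftedStreamLaw μ ν

/-- The law `P_ν` of the data of `N` streams: the streams are independent, and each of them,
independently of the others, undergoes the mean shift `μ` at time `ν` with probability `p`. -/
noncomputable def dataLaw (N : ℕ) (μ p : ℝ) (ν : ℕ∞) : Measure (Sample N) :=
  Measure.pi fun _ : Fin N => streamLaw μ p ν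

/-- The average run length `ARL(T) = E_∞ T`. -/
noncomputable def arl (N : ℕ) (μ p : ℝ) (T : Sample N → ℕ∞) : ℝ≥0∞ :=
  ∫⁻ ω, (T ω : ℝ≥0∞) ∂(dataLaw N μ p ⊤)

/-- The conditional expected delay `E_ν (T - ν + 1 | T ≥ ν)`.
If the event `T ≥ ν` is null, the value is `0`. -/
noncomputable def condDelay (N : ℕ) (μ p : ℝ) (T : Sample N → ℕ∞) (ν : ℕ) : ℝ≥0∞ :=
  ∫⁻ ω, ((T ω : ℝ≥0∞) + 1 - (ν : ℝ≥0∞))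
    ∂(ProbabilityTheory.cond (dataLaw N μ p (ν : ℕ∞)) {ω | (ν : ℕ∞) ≤ T ω})

/-- The detection delay `D_N(T) = sup_{1 ≤ ν < ∞} E_ν (T - ν + 1 | T ≥ ν)`. -/
noncomputable def detectionDelay (N : ℕ) (μ p : ℝ) (T : Sample N → ℕ∞) : ℝ≥0∞ :=
  ⨆ (ν : ℕ) (_ : 1 ≤ ν), condDelay N μ p T ν

/-- The constant `ρ(β, ζ)`, used for `(1 - ζ) / 2 < β < 1 - ζ`. -/
noncomputable def rho (β ζ : ℝ) : ℝ :=
  if β ≤ 3 * (1 - ζ) / 4 then β - (1 - ζ) / 2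
  else (Real.sqrt (1 - ζ) - Real.sqrt (1 - ζ - β)) ^ 2

end MultiStream

/-! Everything happens on a window of k times starting at ν = v + 1. If E_∞ T ≥ γ, averaging over v
yields a v for which, without change and given T > v, the rule stops in the window with probability
at most 2k/γ (`exists_window_le`). To pass to P_ν, let L be the likelihood ratio of the window.
Splitting at level e^x gives L ≤ e^x + e^{-sx} L^{1+s}, and L is independent of the past under P_∞.
Hence P_ν(T ≤ v + k | T > v) ≤ ε with ε = e^x · 2k/γ + e^{-sx} M, where M bounds the moment of L of
order 1 + s, and the delay is at least k(1 - ε) (`le_detectionDelay`). The choice x = (log γ)/2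
makes ε small once log M is of smaller order than s log γ.

For one stream the moment is at most 1 + p^{1+s} exp(k s(1+s)μ²/2) (`lintegral_mixRatio_rpow_le`).
As the leading term is exactly 1, the N-fold product has log M = N p^{1+s} exp(k s(1+s)μ²/2).

In (a), k ≈ c' log N and r = c'μ²/2 give log M of order at most N^{1+(1+s)(rs-β)}. Some s in (0,1]
makes this exponent less than ζ when r < ρ(β, ζ); the two cases of ρ come from s = 1 and from an
interior minimum (`exists_moment_order`). In (b), k ≈ N^δ and s = 1/k keep the exponential bounded,
so log M is O(N^{1-β}) against s log γ ≈ N^{ζ-δ}, and any δ < β + ζ - 1 works. -/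

namespace MultiStream

/-! ### Likelihood ratios of one stream and their moments -/

/-- A product of measures with densities has the product of the densities as its density. -/
theorem pi_withDensity {ι : Type*} [Fintype ι] {α : ι → Type*} [∀ i, MeasurableSpace (α i)]
    (μ : ∀ i, Measure (α i)) [∀ i, IsProbabilityMeasure (μ i)] (f : ∀ i, α i → ℝ≥0∞)
    (hf : ∀ i, Measurable (f i)) [∀ i, SigmaFinite ((μ i).withDensity (f i))] :
    Measure.pi (fun i => (μ i).withDensity (f i)) =
      (Measure.pi μ).withDensity (fun x => ∏ i, f i (x i)) := by
  refine Measure.pi_eq fun s hs => ?_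
  have hind := iIndepFun_pi (μ := μ) (X := fun i => (s i).indicator (f i))
    fun i => ((hf i).indicator (hs i)).aemeasurable
  rw [withDensity_apply _ (MeasurableSet.univ_pi hs),
    ← lintegral_indicator (MeasurableSet.univ_pi hs)]
  have h1 : (Set.univ.pi s).indicator (fun x : ∀ i, α i => ∏ i, f i (x i)) =
      fun x => ∏ i, (s i).indicator (f i) (x i) := by
    funext x
    by_cases hx : x ∈ Set.univ.pi s
    · rw [Set.indicator_of_mem hx]
      exact Finset.prod_congr rfl fun i _ => (Set.indicator_of_mem (hx i trivial) _).symm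
    · rw [Set.indicator_of_notMem hx]
      obtain ⟨i, hi⟩ : ∃ i, x i ∉ s i := by simpa [Set.mem_univ_pi] using hx
      exact (Finset.prod_eq_zero (Finset.mem_univ i) (Set.indicator_of_notMem hi _)).symm
  rw [h1, lintegral_prod_eq_prod_lintegral_of_indepFun Finset.univ _ hind
    fun i => ((hf i).indicator (hs i)).comp (measurable_pi_apply i)]
  refine Finset.prod_congr rfl fun i _ => ?_
  rw [withDensity_apply _ (hs i), ← lintegral_indicator (hs i)]
  exact (measurePreserving_eval μ i).lintegral_comp ((hf i).indicator (hs i))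

/-- Likelihood ratio of `N(μ, 1)` with respect to `N(0, 1)`. -/
noncomputable def gaussianRatio (μ y : ℝ) : ℝ≥0∞ := ENNReal.ofReal (Real.exp (μ * y - μ ^ 2 / 2))

@[fun_prop]
theorem measurable_gaussianRatio (μ : ℝ) : Measurable (gaussianRatio μ) := by
  unfold gaussianRatio; fun_prop

theorem gaussianReal_eq_withDensity (μ : ℝ) :
    gaussianReal μ 1 = (gaussianReal 0 1).withDensity (gaussianRatio μ) := by
  rw [gaussianReal_of_var_ne_zero _ one_ne_zero, gaussianReal_of_var_ne_zero _ one_ne_zero,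
    ← withDensity_mul _ (measurable_gaussianPDF 0 1) (measurable_gaussianRatio μ)]
  congr 1
  funext y
  simp only [Pi.mul_apply, gaussianPDF, gaussianRatio]
  rw [← ENNReal.ofReal_mul (gaussianPDFReal_nonneg _ _ _)]
  simp only [gaussianPDFReal]
  rw [mul_assoc (√_)⁻¹, ← Real.exp_add]
  congr 3
  push_cast
  ring

theorem lintegral_gaussianRatio (μ : ℝ) : ∫⁻ y, gaussianRatio μ y ∂(gaussianReal 0 1) = 1 := by
  rw [← setLIntegral_univ, ← withDensity_apply _ MeasurableSet.univ,
    ← gaussianReal_eq_withDensity, measure_univ]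

/-- The q-th power is a constant times the ratio for mean qμ, which integrates to 1. -/
theorem lintegral_gaussianRatio_rpow (μ q : ℝ) (hq : 0 ≤ q) :
    ∫⁻ y, gaussianRatio μ y ^ q ∂(gaussianReal 0 1) =
      ENNReal.ofReal (Real.exp (q * (q - 1) * μ ^ 2 / 2)) := by
  have h : ∀ y, gaussianRatio μ y ^ q =
      ENNReal.ofReal (Real.exp (q * (q - 1) * μ ^ 2 / 2)) * gaussianRatio (q * μ) y := by
    intro y
    rw [gaussianRatio, gaussianRatio, ENNReal.ofReal_rpow_of_nonneg (Real.exp_pos _).le hq,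
      ← Real.exp_mul, ← ENNReal.ofReal_mul (Real.exp_pos _).le, ← Real.exp_add]
    congr 2
    ring
  simp_rw [h]
  rw [lintegral_const_mul _ (measurable_gaussianRatio _), lintegral_gaussianRatio, mul_one]

/-- Likelihood ratio, over the times with indices in `[v, v + k)`, of an affected stream. -/
noncomputable def windowRatio (μ : ℝ) (v k : ℕ) (x : ℕ → ℝ) : ℝ≥0∞ :=
  ∏ i ∈ Finset.Ico v (v + k), gaussianRatio μ (x i)

/-- Likelihood ratio, over the times with indices in `[v, v + k)`, of a stream that is affected
with probability `p`. -/
noncomputable def mixRatio (μ p : ℝ) (v k : ℕ) (x : ℕ → ℝ) : ℝ≥0∞ :=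
  ENNReal.ofReal (1 - p) + ENNReal.ofReal p * windowRatio μ v k x

@[fun_prop]
theorem measurable_windowRatio (μ : ℝ) (v k : ℕ) : Measurable (windowRatio μ v k) := by
  unfold windowRatio; fun_prop

@[fun_prop]
theorem measurable_mixRatio (μ p : ℝ) (v k : ℕ) : Measurable (mixRatio μ p v k) := by
  unfold mixRatio; fun_prop

instance : IsProbabilityMeasure nullStreamLaw := by unfold nullStreamLaw; infer_instance

instance (μ : ℝ) (ν : ℕ∞) : IsProbabilityMeasure (shiftedStreamLaw μ ν) := by
  unfold shiftedStreamLaw; infer_instance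

theorem streamLaw_isProbabilityMeasure (μ p : ℝ) (hp0 : 0 ≤ p) (hp1 : p ≤ 1) (ν : ℕ∞) :
    IsProbabilityMeasure (streamLaw μ p ν) := by
  constructor
  simp [streamLaw, ← ENNReal.ofReal_add (sub_nonneg.2 hp1) hp0]

theorem iIndepFun_nullStreamLaw : iIndepFun (fun (i : ℕ) (x : ℕ → ℝ) => x i) nullStreamLaw :=
  iIndepFun_infinitePi (P := fun _ : ℕ => gaussianReal 0 1) (X := fun _ y => y)
    fun _ => measurable_id

theorem lintegral_eval_nullStreamLaw (i : ℕ) {f : ℝ → ℝ≥0∞} (hf : Measurable f) :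
    ∫⁻ x, f (x i) ∂nullStreamLaw = ∫⁻ y, f y ∂(gaussianReal 0 1) :=
  (measurePreserving_eval_infinitePi (fun _ : ℕ => gaussianReal 0 1) i).lintegral_comp hf

theorem lintegral_windowRatio_rpow (μ q : ℝ) (hq : 0 ≤ q) (v k : ℕ) :
    ∫⁻ x, windowRatio μ v k x ^ q ∂nullStreamLaw =
      ENNReal.ofReal (Real.exp (k * (q * (q - 1) * μ ^ 2 / 2))) := by
  have h : ∀ x : ℕ → ℝ, windowRatio μ v k x ^ q =
      ∏ i ∈ Finset.Ico v (v + k), gaussianRatio μ (x i) ^ q := fun x =>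
    (ENNReal.prod_rpow_of_nonneg hq).symm
  simp_rw [h]
  have hm : Measurable fun y => gaussianRatio μ y ^ q := by fun_prop
  rw [lintegral_prod_eq_prod_lintegral_of_indepFun _
    (fun (i : ℕ) (x : ℕ → ℝ) => gaussianRatio μ (x i) ^ q)
    (iIndepFun_nullStreamLaw.comp (fun _ y => gaussianRatio μ y ^ q) fun _ => hm)
    fun i => hm.comp (measurable_pi_apply i)]
  simp_rw [lintegral_eval_nullStreamLaw _ hm, lintegral_gaussianRatio_rpow μ q hq]
  rw [Finset.prod_const, Nat.card_Ico, Nat.add_sub_cancel_left,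
    ← ENNReal.ofReal_pow (Real.exp_pos _).le, ← Real.exp_nat_mul]

theorem lintegral_windowRatio (μ : ℝ) (v k : ℕ) :
    ∫⁻ x, windowRatio μ v k x ∂nullStreamLaw = 1 := by
  simpa using lintegral_windowRatio_rpow μ 1 zero_le_one v k

theorem lintegral_mixRatio (μ p : ℝ) (hp0 : 0 ≤ p) (hp1 : p ≤ 1) (v k : ℕ) :
    ∫⁻ x, mixRatio μ p v k x ∂nullStreamLaw = 1 := by
  unfold mixRatio
  rw [lintegral_add_left measurable_const, lintegral_const_mul _ (by fun_prop),
    lintegral_windowRatio, lintegral_const, measure_univ, mul_one, mul_one,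
    ← ENNReal.ofReal_add (sub_nonneg.2 hp1) hp0]
  simp

/-- Concavity: the right side is the tangent at a = 1. Integrated against a density, it gives the
Jensen bound 1 for the s-th moment. -/
theorem rpow_le_affine {s : ℝ} (hs0 : 0 < s) (hs1 : s ≤ 1) (a : ℝ≥0∞) :
    a ^ s ≤ ENNReal.ofReal (1 - s) + ENNReal.ofReal s * a := by
  induction a with
  | top => rw [ENNReal.mul_top (by simpa using hs0)]; simp
  | coe a =>
    have ha : (0 : ℝ) ≤ a := a.2
    have h := Real.geom_mean_le_arith_mean2_weighted (sub_nonneg.2 hs1) hs0.le zero_le_one ha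
      (by ring)
    rw [← ENNReal.ofReal_coe_nnreal, ENNReal.ofReal_rpow_of_nonneg ha hs0.le,
      ← ENNReal.ofReal_mul hs0.le, ← ENNReal.ofReal_add (sub_nonneg.2 hs1) (by positivity)]
    exact ENNReal.ofReal_le_ofReal (by simpa using h)

/-- Write the power as L · L^s with L = (1-p) + pW and expand the first factor. The (1-p) part uses
E L^s ≤ 1; the pW part uses subadditivity, L^s ≤ 1 + (pW)^s. The terms 1 - p and p add up to exactly
1, so no constant is raised to the power N later. -/
theorem lintegral_mixRatio_rpow_le (μ p s : ℝ) (hp0 : 0 < p) (hp1 : p ≤ 1) (hs0 : 0 < s)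
    (hs1 : s ≤ 1) (v k : ℕ) :
    ∫⁻ x, mixRatio μ p v k x ^ (1 + s) ∂nullStreamLaw ≤
      ENNReal.ofReal (1 + p ^ (1 + s) * Real.exp (k * (s * (1 + s) * μ ^ 2 / 2))) := by
  have hs : (0 : ℝ) ≤ 1 + s := by linarith
  have hmean : ∫⁻ x, mixRatio μ p v k x ^ s ∂nullStreamLaw ≤ 1 := by
    refine (lintegral_mono fun x => rpow_le_affine hs0 hs1 _).trans ?_
    rw [lintegral_add_left measurable_const, lintegral_const_mul _ (by fun_prop),
      lintegral_mixRatio μ p hp0.le hp1, lintegral_const, measure_univ, mul_one, mul_one,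
      ← ENNReal.ofReal_add (sub_nonneg.2 hs1) hs0.le]
    simp
  have hpt : ∀ x, mixRatio μ p v k x ^ (1 + s) ≤
      ENNReal.ofReal (1 - p) * mixRatio μ p v k x ^ s +
        (ENNReal.ofReal p * windowRatio μ v k x +
          ENNReal.ofReal (p ^ (1 + s)) * windowRatio μ v k x ^ (1 + s)) := by
    intro x
    have h1 : mixRatio μ p v k x ^ (1 + s) = mixRatio μ p v k x * mixRatio μ p v k x ^ s := by
      rw [ENNReal.rpow_add_of_nonneg _ _ zero_le_one hs0.le, ENNReal.rpow_one]
    rw [h1]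
    nth_rewrite 1 [mixRatio]
    rw [add_mul]
    gcongr
    have h2 : mixRatio μ p v k x ^ s ≤ 1 + (ENNReal.ofReal p * windowRatio μ v k x) ^ s := by
      refine (ENNReal.rpow_add_le_add_rpow _ _ hs0.le hs1).trans ?_
      gcongr
      refine ENNReal.rpow_le_one ?_ hs0.le
      rw [ENNReal.ofReal_le_one]; linarith
    refine (mul_le_mul_right h2 _).trans_eq ?_
    rw [mul_add, mul_one]
    congr 1
    rw [← ENNReal.ofReal_rpow_of_nonneg hp0.le hs, ← ENNReal.mul_rpow_of_nonneg _ _ hs,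
      ENNReal.rpow_add_of_nonneg _ _ zero_le_one hs0.le, ENNReal.rpow_one]
  refine (lintegral_mono hpt).trans ?_
  rw [lintegral_add_left (by fun_prop), lintegral_add_left (by fun_prop),
    lintegral_const_mul _ (by fun_prop), lintegral_const_mul _ (by fun_prop),
    lintegral_const_mul _ (by fun_prop), lintegral_windowRatio,
    lintegral_windowRatio_rpow _ _ hs, mul_one, ← add_assoc,
    ENNReal.ofReal_add zero_le_one (by positivity), ENNReal.ofReal_mul (by positivity)]
  gcongr ?_ + _ * ENNReal.ofReal (Real.exp ?_)
  · calc _ ≤ ENNReal.ofReal (1 - p) * 1 + ENNReal.ofReal p := by gcongr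
      _ = _ := by
        rw [mul_one, ← ENNReal.ofReal_add (sub_nonneg.2 hp1) hp0.le, sub_add_cancel]
  · exact le_of_eq (by ring)

/-! ### Change of measure on a finite horizon -/

/-- The first `m` observations of a stream. -/
def past (m : ℕ) (x : ℕ → ℝ) : Fin m → ℝ := fun i => x i

@[fun_prop]
theorem measurable_past (m : ℕ) : Measurable (past m) := by
  unfold past; fun_prop

theorem map_withDensity_comp {α β : Type*} [MeasurableSpace α] [MeasurableSpace β]
    (μ : Measure α) {r : α → β} (hr : Measurable r) {f : β → ℝ≥0∞} (hf : Measurable f) :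
    (μ.withDensity fun x => f (r x)).map r = (μ.map r).withDensity f := by
  ext s hs
  rw [Measure.map_apply hr hs, withDensity_apply _ (hr hs), withDensity_apply _ hs,
    setLIntegral_map hs hf hr]

theorem map_past_infinitePi (P : ℕ → Measure ℝ) [∀ i, IsProbabilityMeasure (P i)] (m : ℕ) :
    (Measure.infinitePi P).map (past m) = Measure.pi fun i : Fin m => P i := by
  rw [← Measure.infinitePi_eq_pi]
  exact Measure.map_infinitePi_infinitePi_of_inj (P := P) Fin.val_injective

/-- Restriction to finitely many observations is essential: for μ ≠ 0 the laws of whole sequences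
are mutually singular. Index `i` is time i + 1, so a change at ν = v + 1 affects the indices from
`v` on. -/
theorem map_past_shiftedStreamLaw (μ : ℝ) (v k : ℕ) :
    (shiftedStreamLaw μ ((v + 1 : ℕ) : ℕ∞)).map (past (v + k)) =
      (nullStreamLaw.withDensity (windowRatio μ v k)).map (past (v + k)) := by
  set f : Fin (v + k) → ℝ → ℝ≥0∞ := fun i => if v ≤ i then gaussianRatio μ else 1 with hf
  have hfm : ∀ i, Measurable (f i) := by
    intro i
    simp only [hf]
    split_ifs
    · fun_prop
    · exact measurable_const
  have hfi : ∀ i : Fin (v + k), (gaussianReal 0 1).withDensity (f i) =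
      gaussianReal (if ((v + 1 : ℕ) : ℕ∞) ≤ (((i : ℕ) + 1 : ℕ) : ℕ∞) then μ else 0) 1 := by
    intro i
    have hiff : ((v + 1 : ℕ) : ℕ∞) ≤ (((i : ℕ) + 1 : ℕ) : ℕ∞) ↔ v ≤ (i : ℕ) := by
      rw [Nat.cast_le]; omega
    simp only [hf, hiff]
    split_ifs
    · exact (gaussianReal_eq_withDensity μ).symm
    · exact withDensity_one
  have hw : windowRatio μ v k = fun x => (fun y : Fin (v + k) → ℝ => ∏ i, f i (y i))
      (past (v + k) x) := by
    funext x
    simp only [past, windowRatio]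
    rw [Fin.prod_univ_eq_prod_range (fun i => (if v ≤ i then gaussianRatio μ else 1) (x i)),
      Finset.range_eq_Ico, ← Finset.prod_Ico_consecutive _ (Nat.zero_le v) (Nat.le_add_right v k),
      Finset.prod_eq_one (s := Finset.Ico 0 v), one_mul]
    · refine Finset.prod_congr rfl fun i hi => ?_
      rw [if_pos (Finset.mem_Ico.1 hi).1]
    · intro i hi
      rw [if_neg (not_le.2 (Finset.mem_Ico.1 hi).2)]
      rfl
  have : ∀ i, SigmaFinite ((gaussianReal 0 1).withDensity (f i)) := by
    intro i; rw [hfi]; infer_instance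
  have hm : Measurable fun y : Fin (v + k) → ℝ => ∏ i, f i (y i) :=
    Finset.measurable_prod _ fun i _ => (hfm i).comp (measurable_pi_apply i)
  rw [hw, map_withDensity_comp _ (measurable_past _) hm, shiftedStreamLaw, nullStreamLaw,
    map_past_infinitePi, map_past_infinitePi, ← pi_withDensity _ f hfm]
  congr 1
  funext i
  exact (hfi i).symm

theorem map_past_streamLaw (μ p : ℝ) (v k : ℕ) :
    (streamLaw μ p ((v + 1 : ℕ) : ℕ∞)).map (past (v + k)) =
      (nullStreamLaw.withDensity (mixRatio μ p v k)).map (past (v + k)) := by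
  have h : nullStreamLaw.withDensity (mixRatio μ p v k) =
      ENNReal.ofReal (1 - p) • nullStreamLaw +
        ENNReal.ofReal p • nullStreamLaw.withDensity (windowRatio μ v k) := by
    have : mixRatio μ p v k =
      (fun _ => ENNReal.ofReal (1 - p)) + ENNReal.ofReal p • windowRatio μ v k := rfl
    rw [this, withDensity_add_left measurable_const, withDensity_const,
      withDensity_smul _ (measurable_windowRatio μ v k)]
  rw [h, streamLaw, Measure.map_add _ _ (measurable_past _),
    Measure.map_add _ _ (measurable_past _), Measure.map_smul, Measure.map_smul, Measure.map_smul,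
    map_past_shiftedStreamLaw]

/-- The law of the data of `N` streams without change. -/
noncomputable def nullLaw (N : ℕ) : Measure (Sample N) := Measure.pi fun _ : Fin N => nullStreamLaw

instance (N : ℕ) : IsProbabilityMeasure (nullLaw N) := by unfold nullLaw; infer_instance

theorem dataLaw_top (N : ℕ) (μ p : ℝ) (hp0 : 0 ≤ p) (hp1 : p ≤ 1) :
    dataLaw N μ p ⊤ = nullLaw N := by
  have h : streamLaw μ p ⊤ = nullStreamLaw := by
    have h1 : shiftedStreamLaw μ ⊤ = nullStreamLaw := by
      unfold shiftedStreamLaw nullStreamLaw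
      congr 1
    rw [streamLaw, h1, ← add_smul, ← ENNReal.ofReal_add (sub_nonneg.2 hp1) hp0]
    simp
  rw [dataLaw, h, nullLaw]

/-- Measures with the same marginals of the first `m` observations of each stream give the same
probability to the events observed by time `m`. -/
theorem pi_apply_congr_of_observed {N m : ℕ} {P Q : Measure (ℕ → ℝ)} [IsFiniteMeasure P]
    [IsFiniteMeasure Q] (h : P.map (past m) = Q.map (past m)) {A : Set (Sample N)}
    (hA : MeasurableSet[observed N m] A) :
    Measure.pi (fun _ : Fin N => P) A = Measure.pi (fun _ : Fin N => Q) A := by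
  obtain ⟨B, hB, rfl⟩ := hA
  have hR : Measurable fun (ω : Sample N) (n : Fin N) (i : Fin m) => ω n (i : ℕ) := by fun_prop
  have hmap : ∀ (P : Measure (ℕ → ℝ)) [IsFiniteMeasure P],
      (Measure.pi fun _ : Fin N => P).map (fun (ω : Sample N) n (i : Fin m) => ω n (i : ℕ)) =
        Measure.pi fun _ : Fin N => P.map (past m) := by
    intro P _
    exact Measure.pi_map_pi (μ := fun _ : Fin N => P) (f := fun _ => past m)
      fun _ => (measurable_past m).aemeasurable
  rw [← Measure.map_apply hR hB, ← Measure.map_apply hR hB, hmap, hmap, h]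

theorem dataLaw_apply_of_observed {N : ℕ} (μ p : ℝ) (hp0 : 0 ≤ p) (hp1 : p ≤ 1) (v k : ℕ)
    {A : Set (Sample N)} (hA : MeasurableSet[observed N (v + k)] A) :
    dataLaw N μ p ((v + 1 : ℕ) : ℕ∞) A =
      ∫⁻ ω in A, ∏ n, mixRatio μ p v k (ω n) ∂nullLaw N := by
  have := streamLaw_isProbabilityMeasure μ p hp0 hp1 ((v + 1 : ℕ) : ℕ∞)
  have : IsFiniteMeasure (nullStreamLaw.withDensity (mixRatio μ p v k)) :=
    isFiniteMeasure_withDensity (by rw [lintegral_mixRatio μ p hp0 hp1]; exact ENNReal.one_ne_top)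
  rw [dataLaw, pi_apply_congr_of_observed (map_past_streamLaw μ p v k) hA,
    pi_withDensity (fun _ : Fin N => nullStreamLaw) (fun _ => mixRatio μ p v k)
      fun _ => measurable_mixRatio μ p v k, withDensity_apply _ ((observed N).le _ _ hA), nullLaw]

/-! ### Independence of the window from the past -/

theorem indepFun_past_windowRatio (μ : ℝ) (v k : ℕ) :
    IndepFun (past v) (windowRatio μ v k) nullStreamLaw := by
  have h := iIndepFun_nullStreamLaw.indepFun_finset (Finset.range v) (Finset.Ico v (v + k))
    (Finset.disjoint_left.2 fun i hi hi' =>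
      absurd (Finset.mem_range.1 hi) (not_lt.2 (Finset.mem_Ico.1 hi').1))
    fun i => measurable_pi_apply i
  have h2 := h.comp
    (φ := fun (y : Finset.range v → ℝ) (i : Fin v) => y ⟨i, Finset.mem_range.2 i.2⟩)
    (ψ := fun y : Finset.Ico v (v + k) → ℝ => ∏ i, gaussianRatio μ (y i))
    (by fun_prop) (by fun_prop)
  have h3 : windowRatio μ v k = (fun y : Finset.Ico v (v + k) → ℝ => ∏ i, gaussianRatio μ (y i)) ∘
      fun x i => x i := by
    funext x
    exact (Finset.prod_coe_sort (Finset.Ico v (v + k)) fun i => gaussianRatio μ (x i)).symm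
  rw [h3]
  exact h2

/-- By independence, the densities `H` and the constant `c` induce the same law of the first `v`
observations of a stream, so their product measures agree on `A`. -/
theorem setLIntegral_prod_of_indepFun {N : ℕ} {v : ℕ} {H : (ℕ → ℝ) → ℝ≥0∞} (hH : Measurable H)
    (hind : IndepFun (past v) H nullStreamLaw) (hfin : ∫⁻ x, H x ∂nullStreamLaw ≠ ∞)
    {A : Set (Sample N)} (hA : MeasurableSet[observed N v] A) :
    ∫⁻ ω in A, ∏ n, H (ω n) ∂nullLaw N = (∫⁻ x, H x ∂nullStreamLaw) ^ N * nullLaw N A := by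
  have : IsFiniteMeasure (nullStreamLaw.withDensity H) := isFiniteMeasure_withDensity hfin
  set c := ∫⁻ x, H x ∂nullStreamLaw with hc
  have : IsFiniteMeasure (nullStreamLaw.withDensity fun _ => c) :=
    isFiniteMeasure_withDensity (by simpa using hfin)
  have hmap : (nullStreamLaw.withDensity H).map (past v) =
      (nullStreamLaw.withDensity fun _ => c).map (past v) := by
    ext s hs
    have hps := measurable_past v hs
    rw [Measure.map_apply (measurable_past v) hs, Measure.map_apply (measurable_past v) hs,
      withDensity_apply _ hps, withDensity_const, Measure.smul_apply, smul_eq_mul,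
      ← lintegral_indicator hps]
    have h1 : (past v ⁻¹' s).indicator H =
        ((s.indicator 1 : (Fin v → ℝ) → ℝ≥0∞) ∘ past v) * H := by
      funext x
      by_cases hx : past v x ∈ s <;> simp [Set.indicator, hx]
    have hi := hind.comp (φ := (s.indicator 1 : (Fin v → ℝ) → ℝ≥0∞)) (ψ := id)
      (measurable_one.indicator hs) measurable_id
    rw [h1, lintegral_mul_eq_lintegral_mul_lintegral_of_indepFun
      ((measurable_one.indicator hs).comp (measurable_past v)) hH hi, mul_comm]
    congr 1
    rw [← lintegral_indicator_one hps]
    rfl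
  have h := pi_apply_congr_of_observed (N := N) hmap hA
  rw [pi_withDensity (fun _ : Fin N => nullStreamLaw) (fun _ => H) fun _ => hH,
    pi_withDensity (fun _ : Fin N => nullStreamLaw) (fun _ _ => c) fun _ => measurable_const,
    withDensity_apply _ ((observed N).le _ _ hA)] at h
  rw [nullLaw, h]
  simp [withDensity_const]

theorem setLIntegral_prod_mixRatio_rpow_le {N : ℕ} (μ p s : ℝ) (hp0 : 0 < p) (hp1 : p ≤ 1)
    (hs0 : 0 < s) (hs1 : s ≤ 1) (v k : ℕ) {A : Set (Sample N)}
    (hA : MeasurableSet[observed N v] A) :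
    ∫⁻ ω in A, (∏ n, mixRatio μ p v k (ω n)) ^ (1 + s) ∂nullLaw N ≤
      ENNReal.ofReal (Real.exp (N * (p ^ (1 + s) *
        Real.exp (k * (s * (1 + s) * μ ^ 2 / 2))))) * nullLaw N A := by
  have hle := lintegral_mixRatio_rpow_le μ p s hp0 hp1 hs0 hs1 v k
  have hm : Measurable fun x => mixRatio μ p v k x ^ (1 + s) := by fun_prop
  have hind : IndepFun (past v) (fun x => mixRatio μ p v k x ^ (1 + s)) nullStreamLaw :=
    (indepFun_past_windowRatio μ v k).comp (φ := id)
      (ψ := fun y => (ENNReal.ofReal (1 - p) + ENNReal.ofReal p * y) ^ (1 + s))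
      measurable_id (by fun_prop)
  have h := setLIntegral_prod_of_indepFun hm hind (hle.trans_lt ENNReal.ofReal_lt_top).ne hA
  simp_rw [← ENNReal.prod_rpow_of_nonneg (show (0 : ℝ) ≤ 1 + s by linarith)]
  rw [h, Real.exp_nat_mul, ENNReal.ofReal_pow (Real.exp_pos _).le]
  gcongr
  refine hle.trans (ENNReal.ofReal_le_ofReal ?_)
  rw [add_comm]
  exact Real.add_one_le_exp _

/-- A window of length 0 has likelihood ratio 1. -/
theorem dataLaw_apply_of_observed_before {N : ℕ} (μ p : ℝ) (hp0 : 0 ≤ p) (hp1 : p ≤ 1) (v : ℕ)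
    {A : Set (Sample N)} (hA : MeasurableSet[observed N v] A) :
    dataLaw N μ p ((v + 1 : ℕ) : ℕ∞) A = nullLaw N A := by
  have h := dataLaw_apply_of_observed μ p hp0 hp1 v 0 hA
  have h1 : ∀ x, mixRatio μ p v 0 x = 1 := by
    intro x
    simp [mixRatio, windowRatio, ← ENNReal.ofReal_add (sub_nonneg.2 hp1) hp0]
  rw [h]
  simp [h1]

/-! ### Random times with a large mean -/

theorem tsum_ite_lt_eq (t : ℕ∞) : ∑' v : ℕ, (if (v : ℕ∞) < t then (1 : ℝ≥0∞) else 0) = t := by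
  induction t with
  | top => simp
  | coe n =>
    rw [tsum_eq_sum (s := Finset.range n)]
    · rw [Finset.sum_congr rfl (g := fun _ => 1)]
      · simp
      · intro i hi
        rw [if_pos (Nat.cast_lt.2 (Finset.mem_range.1 hi))]
    · intro i hi
      rw [if_neg]
      rw [Nat.cast_lt]
      simpa using hi

theorem tsum_ite_window_le (t : ℕ∞) (k : ℕ) :
    ∑' v : ℕ, (if (v : ℕ∞) < t ∧ t ≤ (v + k : ℕ) then (1 : ℝ≥0∞) else 0) ≤ k := by
  induction t with
  | top =>
    rw [ENNReal.tsum_eq_zero.2 fun v => if_neg fun h => ENat.natCast_ne_top _ (top_le_iff.1 h.2)]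
    exact zero_le
  | coe n =>
    rw [tsum_eq_sum (s := Finset.Ico (n - k) n)]
    · calc _ ≤ ∑ _v ∈ Finset.Ico (n - k) n, (1 : ℝ≥0∞) :=
          Finset.sum_le_sum fun i _ => by split_ifs <;> simp
        _ ≤ k := by
          simp only [Finset.sum_const, Nat.card_Ico, nsmul_eq_mul, mul_one]
          exact_mod_cast (by omega : n - (n - k) ≤ k)
    · intro i hi
      rw [if_neg]
      rw [Nat.cast_lt, Nat.cast_le]
      rw [Finset.mem_Ico] at hi
      omega

/-- A random time with mean at least `γ` has, from some time `v` on, conditional probability at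
most `2 k / γ` to fall into the next `k` time points. -/
theorem exists_window_le {Ω : Type*} [MeasurableSpace Ω] (P : Measure Ω) [IsProbabilityMeasure P]
    (T : Ω → ℕ∞) (hT : ∀ n : ℕ, MeasurableSet {ω | T ω ≤ n}) {γ : ℝ} (hγ : 0 < γ)
    (hmean : ENNReal.ofReal γ ≤ ∫⁻ ω, (T ω : ℝ≥0∞) ∂P) {k : ℕ} (hk : 1 ≤ k) :
    ∃ v : ℕ, P {ω | (v : ℕ∞) < T ω} ≠ 0 ∧
      P {ω | (v : ℕ∞) < T ω ∧ T ω ≤ (v + k : ℕ)} ≤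
        ENNReal.ofReal (2 * k / γ) * P {ω | (v : ℕ∞) < T ω} := by
  -- Otherwise summing over `v` gives (2k/γ) · E T ≤ k: the tails sum to E T, and each value of `T`
  -- lies in at most `k` windows. As E T ≥ γ, this means 2k ≤ k. Null tails satisfy the reversed
  -- bound trivially.
  by_contra! hcon
  have hB : ∀ v : ℕ, MeasurableSet {ω | (v : ℕ∞) < T ω} := by
    intro v
    have h := (hT v).compl
    simpa only [Set.compl_ofPred, not_le] using h
  have hA : ∀ v : ℕ, MeasurableSet {ω | (v : ℕ∞) < T ω ∧ T ω ≤ (v + k : ℕ)} :=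
    fun v => (hB v).inter (hT _)
  have hle : ∀ v : ℕ, ENNReal.ofReal (2 * k / γ) * P {ω | (v : ℕ∞) < T ω} ≤
      P {ω | (v : ℕ∞) < T ω ∧ T ω ≤ (v + k : ℕ)} := by
    intro v
    by_cases h : P {ω | (v : ℕ∞) < T ω} = 0
    · simp [h]
    · exact (hcon v h).le
  have h1 : ∑' v : ℕ, P {ω | (v : ℕ∞) < T ω} = ∫⁻ ω, (T ω : ℝ≥0∞) ∂P := by
    simp_rw [← tsum_ite_lt_eq]
    rw [lintegral_tsum fun v => (Measurable.ite (hB v) measurable_const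
      measurable_const).aemeasurable]
    refine tsum_congr fun v => ?_
    rw [← lintegral_indicator_one (hB v)]
    simp only [Set.indicator_apply, Set.mem_ofPred_eq, Pi.one_apply]
  have h2 : ∑' v : ℕ, P {ω | (v : ℕ∞) < T ω ∧ T ω ≤ (v + k : ℕ)} ≤ k := by
    calc _ = ∫⁻ ω, ∑' v : ℕ,
          (if (v : ℕ∞) < T ω ∧ T ω ≤ (v + k : ℕ) then (1 : ℝ≥0∞) else 0) ∂P := by
          rw [lintegral_tsum fun v => (Measurable.ite (hA v) measurable_const
            measurable_const).aemeasurable]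
          refine tsum_congr fun v => ?_
          rw [← lintegral_indicator_one (hA v)]
          simp only [Set.indicator_apply, Set.mem_ofPred_eq, Pi.one_apply]
      _ ≤ ∫⁻ _, (k : ℝ≥0∞) ∂P := lintegral_mono fun ω => tsum_ite_window_le _ _
      _ = k := by simp
  have h3 := (ENNReal.tsum_le_tsum hle).trans h2
  rw [ENNReal.tsum_mul_left, h1] at h3
  have h4 := (mul_le_mul_right hmean (ENNReal.ofReal (2 * k / γ))).trans h3
  rw [← ENNReal.ofReal_mul (by positivity), div_mul_cancel₀ _ hγ.ne',
    ← ENNReal.ofReal_natCast, ENNReal.ofReal_le_ofReal_iff (by positivity)] at h4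
  have : (1 : ℝ) ≤ k := by exact_mod_cast hk
  linarith

/-! ### Lower bound for the delay with a fixed number of streams -/

/-- Above the level e^x one has 1 ≤ e^{-sx} L^s. -/
theorem le_exp_add_rpow (s x : ℝ) (hs : 0 < s) (L : ℝ≥0∞) :
    L ≤ ENNReal.ofReal (Real.exp x) + ENNReal.ofReal (Real.exp (-(s * x))) * L ^ (1 + s) := by
  rcases le_total L (ENNReal.ofReal (Real.exp x)) with h | h
  · exact h.trans le_self_add
  · refine le_trans ?_ le_add_self
    have h1 : ENNReal.ofReal (Real.exp (s * x)) ≤ L ^ s := by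
      refine le_trans (le_of_eq ?_) (ENNReal.rpow_le_rpow h hs.le)
      rw [ENNReal.ofReal_rpow_of_nonneg (Real.exp_pos _).le hs.le, ← Real.exp_mul, mul_comm]
    rw [ENNReal.rpow_add_of_nonneg _ _ zero_le_one hs.le, ENNReal.rpow_one, mul_left_comm]
    refine le_mul_of_one_le_right' ?_
    refine le_trans (le_of_eq ?_) (mul_le_mul_right h1 _)
    rw [← ENNReal.ofReal_mul (Real.exp_pos _).le, ← Real.exp_add]
    simp

theorem le_detectionDelay {N : ℕ} {μ p γ s : ℝ} (hp0 : 0 < p) (hp1 : p ≤ 1) (hγ : 0 < γ)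
    (hs0 : 0 < s) (hs1 : s ≤ 1) {T : Sample N → ℕ∞} (hT : IsStoppingTime (observed N) T)
    (hARL : ENNReal.ofReal γ ≤ arl N μ p T) {k : ℕ} (hk : 1 ≤ k) (x : ℝ) :
    ENNReal.ofReal (k * (1 - (Real.exp x * (2 * k / γ) + Real.exp (-(s * x)) *
      Real.exp (N * (p ^ (1 + s) * Real.exp (k * (s * (1 + s) * μ ^ 2 / 2))))))) ≤
      detectionDelay N μ p T := by
  set M := Real.exp (N * (p ^ (1 + s) * Real.exp (k * (s * (1 + s) * μ ^ 2 / 2)))) with hM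
  set ε := Real.exp x * (2 * k / γ) + Real.exp (-(s * x)) * M with hε
  have hε0 : 0 ≤ ε := by positivity
  rw [arl, dataLaw_top N μ p hp0.le hp1] at hARL
  obtain ⟨v, hv0, hv⟩ := exists_window_le (nullLaw N) T
    (fun n => (observed N).le n _ (hT n)) hγ hARL hk
  set B := {ω | (v : ℕ∞) < T ω} with hBdef
  set A := {ω | (v : ℕ∞) < T ω ∧ T ω ≤ (v + k : ℕ)} with hAdef
  set A' := {ω | ((v + k : ℕ) : ℕ∞) < T ω} with hA'def
  have hB : MeasurableSet[observed N v] B := by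
    have h : MeasurableSet[observed N v] {ω | T ω ≤ v}ᶜ := MeasurableSet.compl (hT v)
    simpa only [Set.compl_ofPred, not_le] using h
  have hA : MeasurableSet[observed N (v + k)] A :=
    MeasurableSet.inter ((observed N).mono (Nat.le_add_right v k) _ hB) (hT (v + k))
  have hA' : MeasurableSet A' := by
    have h : MeasurableSet {ω | T ω ≤ (v + k : ℕ)}ᶜ := ((observed N).le _ _ (hT (v + k))).compl
    simpa only [Set.compl_ofPred, not_le] using h
  have hBm := (observed N).le _ _ hB
  have hAm := (observed N).le _ _ hA
  set Q := dataLaw N μ p ((v + 1 : ℕ) : ℕ∞) with hQ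
  have hQB : Q B = nullLaw N B := dataLaw_apply_of_observed_before μ p hp0.le hp1 v hB
  have hQA : Q A ≤ ENNReal.ofReal ε * Q B := by
    rw [hQ, dataLaw_apply_of_observed μ p hp0.le hp1 v k hA, ← hQ, hQB]
    have hm : Measurable fun ω : Sample N => ∏ n, mixRatio μ p v k (ω n) :=
      Finset.measurable_prod _ fun n _ => (measurable_mixRatio μ p v k).comp (measurable_pi_apply n)
    calc _ ≤ ∫⁻ ω in A, (ENNReal.ofReal (Real.exp x) + ENNReal.ofReal (Real.exp (-(s * x))) *
            (∏ n, mixRatio μ p v k (ω n)) ^ (1 + s)) ∂nullLaw N :=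
          lintegral_mono fun ω => le_exp_add_rpow s x hs0 _
      _ = ENNReal.ofReal (Real.exp x) * nullLaw N A + ENNReal.ofReal (Real.exp (-(s * x))) *
            ∫⁻ ω in A, (∏ n, mixRatio μ p v k (ω n)) ^ (1 + s) ∂nullLaw N := by
          rw [lintegral_add_left measurable_const, setLIntegral_const,
            lintegral_const_mul _ (hm.pow_const _)]
      _ ≤ ENNReal.ofReal (Real.exp x) * (ENNReal.ofReal (2 * k / γ) * nullLaw N B) +
            ENNReal.ofReal (Real.exp (-(s * x))) * (ENNReal.ofReal M * nullLaw N B) := by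
          gcongr
          -- The moment is integrated over the larger set `B`, which belongs to the past at time
          -- `v`, unlike `A`.
          exact (lintegral_mono_set fun ω h => h.1).trans
            (setLIntegral_prod_mixRatio_rpow_le μ p s hp0 hp1 hs0 hs1 v k hB)
      _ = ENNReal.ofReal ε * nullLaw N B := by
          rw [hε, ENNReal.ofReal_add (by positivity) (by positivity),
            ENNReal.ofReal_mul (Real.exp_pos _).le, ENNReal.ofReal_mul (Real.exp_pos _).le]
          ring
  have hQB0 : Q B ≠ 0 := by rwa [hQB]
  have hQBt : Q B ≠ ∞ := by rw [hQB]; exact measure_ne_top _ _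
  have hBAA' : Q B ≤ Q A + Q A' := by
    refine (measure_mono fun ω hω => ?_).trans (measure_union_le A A')
    rcases le_or_gt (T ω) ((v + k : ℕ) : ℕ∞) with h | h
    · exact Or.inl ⟨hω, h⟩
    · exact Or.inr h
  have hevent : {ω | ((v + 1 : ℕ) : ℕ∞) ≤ T ω} = B := by
    ext ω
    simp only [hBdef, Set.mem_ofPred_eq, Nat.cast_add, Nat.cast_one]
    exact ENat.add_one_le_iff (ENat.natCast_ne_top v)
  have hsub : A' ⊆ B := by
    intro ω hω
    simp only [hA'def, hBdef, Set.mem_ofPred_eq] at hω ⊢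
    exact lt_of_le_of_lt (Nat.cast_le.2 (Nat.le_add_right v k)) hω
  -- Since `B` is covered by `A` and `A'`, the conditional probability of `A'` is at least 1 minus
  -- that of `A`. If ε > 1, truncation makes the left side 0.
  have hcond : ENNReal.ofReal (1 - ε) ≤ ProbabilityTheory.cond Q B A' := by
    rw [cond_apply hBm, Set.inter_eq_right.2 hsub, ENNReal.ofReal_sub _ hε0, ENNReal.ofReal_one,
      tsub_le_iff_left, ← ENNReal.inv_mul_cancel hQB0 hQBt]
    refine (mul_le_mul_right hBAA' _).trans ?_
    rw [mul_add]
    gcongr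
    rw [mul_comm, ← ENNReal.div_eq_inv_mul.trans (mul_comm _ _)]
    exact ENNReal.div_le_of_le_mul hQA
  calc ENNReal.ofReal (k * (1 - ε)) = k * ENNReal.ofReal (1 - ε) := by
        rw [ENNReal.ofReal_mul (by positivity), ENNReal.ofReal_natCast]
    _ ≤ k * ProbabilityTheory.cond Q B A' := by gcongr
    _ = ∫⁻ ω, A'.indicator (fun _ => (k : ℝ≥0∞)) ω ∂ProbabilityTheory.cond Q B :=
        (lintegral_indicator_const hA' _).symm
    _ ≤ condDelay N μ p T (v + 1) := by
        rw [condDelay, hevent]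
        -- With ν = v + 1 the delay T + 1 - ν is T - v, which is at least `k` on `A'`.
        refine lintegral_mono (Set.indicator_le fun ω hω => ?_)
        have h1 : ((v + k : ℕ) : ℝ≥0∞) ≤ (T ω : ℝ≥0∞) := by
          rw [← ENat.toENNReal_coe]
          exact ENat.toENNReal_le.2 (le_of_lt hω)
        refine ENNReal.le_sub_of_add_le_left (ENNReal.natCast_ne_top _) ?_
        refine le_trans (le_of_eq ?_) (add_le_add_left h1 1)
        push_cast
        ring
    _ ≤ detectionDelay N μ p T :=
        le_iSup₂_of_le (v + 1) (Nat.le_add_left 1 v) le_rfl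

/-! ### Choice of the moment order and limits of the error terms -/

theorem rho_pos {β ζ : ℝ} (h1 : (1 - ζ) / 2 < β) (h2 : β < 1 - ζ) : 0 < rho β ζ := by
  rw [rho]
  split_ifs with h
  · linarith
  · have : Real.sqrt (1 - ζ - β) < Real.sqrt (1 - ζ) :=
      Real.sqrt_lt_sqrt (by linarith) (by linarith)
    exact pow_pos (by linarith) 2

/-- For `r` below `ρ(β, ζ)`, a moment of order `1 + s` of the likelihood ratio is small. -/
theorem exists_moment_order {β ζ r : ℝ} (h2 : β < 1 - ζ) (hr0 : 0 < r) (hr : r < rho β ζ) :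
    ∃ s : ℝ, 0 < s ∧ s ≤ 1 ∧ 1 + (1 + s) * (r * s - β) < ζ := by
  -- This is exactly the condition under which s = 1 works.
  by_cases h3 : r < β - (1 - ζ) / 2
  · exact ⟨1, one_pos, le_rfl, by linarith⟩
  have hβζ : ¬ β ≤ 3 * (1 - ζ) / 4 := fun h => h3 (by rwa [rho, if_pos h] at hr)
  rw [rho, if_neg hβζ] at hr
  have hw : 0 < 1 - ζ := by linarith
  have hwβ : 0 < 1 - ζ - β := by linarith
  set a := Real.sqrt (1 - ζ) with ha
  set b := Real.sqrt (1 - ζ - β) with hb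
  have ha2 : a ^ 2 = 1 - ζ := Real.sq_sqrt hw.le
  have hb2 : b ^ 2 = 1 - ζ - β := Real.sq_sqrt hwβ.le
  have hb0 : 0 < b := Real.sqrt_pos.2 hwβ
  have hab : b < a := Real.sqrt_lt_sqrt hwβ.le (by linarith)
  set t := Real.sqrt r with ht
  have ht0 : 0 < t := Real.sqrt_pos.2 hr0
  have ht2 : t ^ 2 = r := Real.sq_sqrt hr0.le
  have hta : t < a - b := by
    rw [ht]
    exact (Real.sqrt_lt' (by linarith)).2 hr
  have hβ : β = a ^ 2 - b ^ 2 := by linarith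
  have hrβ : r < β := by nlinarith
  -- The minimiser of (1+s)(rs-β). It is at most 1 iff β ≤ 3r, which follows from r ≥ β - (1-ζ)/2
  -- and β > 3(1-ζ)/4.
  refine ⟨(β - r) / (2 * r), div_pos (by linarith) (by linarith), ?_, ?_⟩
  · rw [div_le_one (by linarith)]
    linarith
  · have e : (1 + (β - r) / (2 * r)) * (r * ((β - r) / (2 * r)) - β) = -((β + r) ^ 2 / (4 * r)) := by
      field_simp
      ring
    rw [e]
    have h4 : (1 - ζ) * (4 * r) < (β + r) ^ 2 := by
      rw [← ha2, ← ht2]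
      -- As β = a² - b², this is (a - t)² > b², a consequence of t < a - b.
      have h5 : 2 * a * t < β + t ^ 2 := by
        nlinarith [mul_pos (show 0 < a - b - t by linarith) (show 0 < a + b - t by linarith)]
      nlinarith [mul_pos (show 0 < a by linarith) ht0]
    rw [← lt_div_iff₀ (by linarith)] at h4
    linarith

theorem tendsto_exp_neg_rpow {a b C d : ℝ} (ha : 0 < a) (hb : 0 < b) (hd : d < b) :
    Tendsto (fun N : ℕ => Real.exp (-(a * (N : ℝ) ^ b) + C * (N : ℝ) ^ d)) atTop (nhds 0) := by
  refine Real.tendsto_exp_atBot.comp ?_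
  have h1 : Tendsto (fun N : ℕ => (N : ℝ) ^ b) atTop atTop :=
    (tendsto_rpow_atTop hb).comp tendsto_natCast_atTop_atTop
  have h2 : Tendsto (fun N : ℕ => (N : ℝ) ^ (d - b)) atTop (nhds 0) := by
    have := (tendsto_rpow_neg_atTop (sub_pos.2 hd)).comp (tendsto_natCast_atTop_atTop (R := ℝ))
    simpa [Function.comp_def] using this
  have h3 : Tendsto (fun N : ℕ => -a + C * (N : ℝ) ^ (d - b)) atTop (nhds (-a)) := by
    simpa using (h2.const_mul C).const_add (-a)
  refine (h1.atTop_mul_neg (neg_lt_zero.2 ha) h3).congr' ?_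
  filter_upwards [eventually_gt_atTop 0] with N hN
  have hN' : (0 : ℝ) < N := by exact_mod_cast hN
  have : (N : ℝ) ^ d = (N : ℝ) ^ b * (N : ℝ) ^ (d - b) := by
    rw [← Real.rpow_add hN']; congr 1; ring
  rw [this]; ring

theorem tendsto_mul_exp_neg_rpow (C : ℝ) {a b : ℝ} (ha : 0 < a) (hb : 0 < b) :
    Tendsto (fun N : ℕ => C * N * Real.exp (-(a * (N : ℝ) ^ b))) atTop (nhds 0) := by
  have h1 : Tendsto (fun N : ℕ => (N : ℝ) ^ b) atTop atTop :=
    (tendsto_rpow_atTop hb).comp tendsto_natCast_atTop_atTop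
  have h2 := ((tendsto_rpow_mul_exp_neg_mul_atTop_nhds_zero (1 / b) a ha).comp h1).const_mul C
  rw [mul_zero] at h2
  refine h2.congr fun N => ?_
  simp only [Function.comp]
  rw [← Real.rpow_mul (Nat.cast_nonneg N), mul_one_div_cancel hb.ne', Real.rpow_one]
  ring_nf

section Asymptotics

variable {u v : ℕ → ℝ}

theorem eventually_le_two_mul (h : u ~[atTop] v) (hv : ∀ᶠ N in atTop, 0 < v N) :
    ∀ᶠ N in atTop, u N ≤ 2 * v N := by
  have h1 := (isEquivalent_iff_tendsto_one (hv.mono fun N hN => hN.ne')).1 h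
  filter_upwards [h1.eventually_lt_const one_lt_two, hv] with N h2 h3
  exact ((div_lt_iff₀ h3).1 h2).le

theorem eventually_half_mul_le (h : u ~[atTop] v) (hv : ∀ᶠ N in atTop, 0 < v N) :
    ∀ᶠ N in atTop, v N / 2 ≤ u N := by
  have h1 := (isEquivalent_iff_tendsto_one (hv.mono fun N hN => hN.ne')).1 h
  filter_upwards [h1.eventually_const_lt one_half_lt_one, hv] with N h2 h3
  have := (lt_div_iff₀ h3).1 h2
  linarith

end Asymptotics

theorem eventually_rpow_pos (b : ℝ) : ∀ᶠ N : ℕ in atTop, 0 < (N : ℝ) ^ b := by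
  filter_upwards [eventually_gt_atTop 0] with N hN
  exact Real.rpow_pos_of_pos (by exact_mod_cast hN) b

/-- The choice `x = log γ / 2` in `le_detectionDelay`. -/
theorem le_detectionDelay_of_log {N : ℕ} {μ p γ s : ℝ} (hp0 : 0 < p) (hp1 : p ≤ 1) (hγ : 0 < γ)
    (hs0 : 0 < s) (hs1 : s ≤ 1) {T : Sample N → ℕ∞} (hT : IsStoppingTime (observed N) T)
    (hARL : ENNReal.ofReal γ ≤ arl N μ p T) {k : ℕ} (hk : 1 ≤ k) {g e₁ e₂ : ℝ}
    (hg : g / 2 ≤ Real.log γ) (h1 : 2 * k * Real.exp (-(1 / 4 * g)) ≤ e₁)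
    (h2 : Real.exp (-(s * (g / 4)) + N * (p ^ (1 + s) *
      Real.exp (k * (s * (1 + s) * μ ^ 2 / 2)))) ≤ e₂) :
    ENNReal.ofReal (k * (1 - (e₁ + e₂))) ≤ detectionDelay N μ p T := by
  refine le_trans (ENNReal.ofReal_le_ofReal ?_)
    (le_detectionDelay hp0 hp1 hγ hs0 hs1 hT hARL hk (Real.log γ / 2))
  gcongr
  · refine le_trans (le_of_eq_of_le (b := 2 * k * Real.exp (-(Real.log γ / 2))) ?_ ?_) h1
    · have : Real.exp (Real.log γ / 2) / γ = Real.exp (-(Real.log γ / 2)) := by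
        nth_rewrite 2 [← Real.exp_log hγ]
        rw [← Real.exp_sub]
        congr 1
        ring
      rw [← this]
      ring
    · exact mul_le_mul_of_nonneg_left (Real.exp_le_exp.2 (by linarith)) (by positivity)
  · rw [← Real.exp_add]
    refine le_trans (Real.exp_le_exp.2 (add_le_add_left ?_ _)) h2
    have : s * (g / 4) ≤ s * (Real.log γ / 2) :=
      mul_le_mul_of_nonneg_left (by linarith) hs0.le
    linarith

/-! ### Growth of the delay in the two regimes -/

theorem eventually_mul_log_le_detectionDelay
    {μ β ζ : ℝ} (hμ : 0 < μ) (hζ0 : 0 < ζ) {p γ : ℕ → ℝ}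
    (hp : ∀ N : ℕ, 1 ≤ N → 0 < p N ∧ p N < 1) (hγ : ∀ N : ℕ, 1 ≤ N → 1 ≤ γ N)
    (hpN : p ~[atTop] fun N : ℕ => (N : ℝ) ^ (-β))
    (hγN : (fun N : ℕ => Real.log (γ N)) ~[atTop] fun N : ℕ => (N : ℝ) ^ ζ)
    {T : (N : ℕ) → Sample N → ℕ∞}
    (hT : ∀ N : ℕ, 1 ≤ N → IsStoppingTime (observed N) (T N))
    (hARL : ∀ N : ℕ, 1 ≤ N → ENNReal.ofReal (γ N) ≤ arl N μ (p N) (T N))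
    (h2 : β < 1 - ζ) {c c' : ℝ} (hc0 : 0 < c) (hcc' : c < c')
    (hc' : c' < 2 / μ ^ 2 * rho β ζ) :
    ∀ᶠ N : ℕ in atTop, ENNReal.ofReal (c * Real.log N) ≤ detectionDelay N μ (p N) (T N) := by
  have hc'0 : 0 < c' := hc0.trans hcc'
  -- For k ≈ c' log N, the factor e^{kμ²/2} is about N^r with this `r`.
  obtain ⟨s, hs0, hs1, hs⟩ := exists_moment_order (r := c' * μ ^ 2 / 2) h2 (by positivity) (by
    rw [div_mul_eq_mul_div, lt_div_iff₀ (by positivity)] at hc'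
    linarith)
  set d := 1 + (1 + s) * (c' * μ ^ 2 / 2 * s - β) with hd
  set k : ℕ → ℕ := fun N => ⌊c' * Real.log N⌋₊ with hk
  have hlog : Tendsto (fun N : ℕ => Real.log N) atTop atTop :=
    Real.tendsto_log_atTop.comp tendsto_natCast_atTop_atTop
  have hkt : Tendsto (fun N : ℕ => (k N : ℝ) / Real.log N) atTop (nhds c') :=
    (tendsto_nat_floor_mul_div_atTop hc'0.le).comp hlog
  have he1 := tendsto_mul_exp_neg_rpow (2 * c') (show (0 : ℝ) < 1 / 4 by norm_num) hζ0
  have he2 := tendsto_exp_neg_rpow (C := 2 ^ (1 + s)) (show 0 < s / 4 by linarith) hζ0 hs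
  -- The bound k(1 - ε), divided by log N, tends to c' > c; this gap absorbs both the floor and the
  -- error.
  have hlim := hkt.mul ((he1.add he2).const_sub 1)
  rw [add_zero, sub_zero, mul_one] at hlim
  filter_upwards [hlim.eventually_const_lt hcc', eventually_le_two_mul hpN (eventually_rpow_pos _),
    eventually_half_mul_le hγN (eventually_rpow_pos _), eventually_ge_atTop 2,
    hlog.eventually_ge_atTop (1 / c')] with N hN hpN' hγN' hN2 hlogN
  have hN0 : (0 : ℝ) < N := by exact_mod_cast (by omega : 0 < N)
  have hL : 0 < Real.log N := Real.log_pos (by exact_mod_cast (by omega : 1 < N))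
  have hk1 : 1 ≤ k N := by
    refine Nat.le_floor ?_
    rw [div_le_iff₀ hc'0] at hlogN
    simpa [mul_comm] using hlogN
  have hkle : (k N : ℝ) ≤ c' * Real.log N := Nat.floor_le (by positivity)
  obtain ⟨hp0, hp1⟩ := hp N (by omega)
  refine le_trans (ENNReal.ofReal_le_ofReal ?_) (le_detectionDelay_of_log hp0 hp1.le
    (zero_lt_one.trans_le (hγ N (by omega))) hs0 hs1 (hT N (by omega)) (hARL N (by omega)) hk1
    hγN' (e₁ := 2 * c' * N * Real.exp (-(1 / 4 * (N : ℝ) ^ ζ)))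
    (e₂ := Real.exp (-(s / 4 * (N : ℝ) ^ ζ) + 2 ^ (1 + s) * (N : ℝ) ^ d)) ?_ ?_)
  · rw [div_mul_eq_mul_div, lt_div_iff₀ hL] at hN
    exact hN.le
  · rw [mul_assoc 2 c']
    gcongr
    refine hkle.trans ?_
    gcongr
    exact Real.log_le_self hN0.le
  · refine Real.exp_le_exp.2 (add_le_add (le_of_eq (by ring)) ?_)
    calc (N : ℝ) * (p N ^ (1 + s) * Real.exp (k N * (s * (1 + s) * μ ^ 2 / 2)))
        ≤ N * ((2 * (N : ℝ) ^ (-β)) ^ (1 + s) *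
            Real.exp (c' * Real.log N * (s * (1 + s) * μ ^ 2 / 2))) := by
          gcongr
      _ = 2 ^ (1 + s) * (N : ℝ) ^ d := by
          rw [Real.mul_rpow zero_le_two (Real.rpow_nonneg hN0.le _), ← Real.rpow_mul hN0.le,
            show c' * Real.log N * (s * (1 + s) * μ ^ 2 / 2) =
              Real.log N * (c' * (s * (1 + s) * μ ^ 2 / 2)) by ring,
            ← Real.rpow_def_of_pos hN0]
          have hd' : (N : ℝ) ^ d = (N : ℝ) ^ (1 : ℝ) * (N : ℝ) ^ (-β * (1 + s)) *
              (N : ℝ) ^ (c' * (s * (1 + s) * μ ^ 2 / 2)) := by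
            rw [← Real.rpow_add hN0, ← Real.rpow_add hN0]
            congr 1
            rw [hd]
            ring
          rw [hd', Real.rpow_one]
          ring

theorem eventually_rpow_le_detectionDelay
    {μ β ζ : ℝ} (hζ0 : 0 < ζ) (hζ1 : ζ < 1) (hβ1 : β < 1) {p γ : ℕ → ℝ}
    (hp : ∀ N : ℕ, 1 ≤ N → 0 < p N ∧ p N < 1) (hγ : ∀ N : ℕ, 1 ≤ N → 1 ≤ γ N)
    (hpN : p ~[atTop] fun N : ℕ => (N : ℝ) ^ (-β))
    (hγN : (fun N : ℕ => Real.log (γ N)) ~[atTop] fun N : ℕ => (N : ℝ) ^ ζ)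
    {T : (N : ℕ) → Sample N → ℕ∞}
    (hT : ∀ N : ℕ, 1 ≤ N → IsStoppingTime (observed N) (T N))
    (hARL : ∀ N : ℕ, 1 ≤ N → ENNReal.ofReal (γ N) ≤ arl N μ (p N) (T N))
    {d δ : ℝ} (hd0 : 0 < d) (hdδ : d < δ) (hδ : δ < β + ζ - 1) :
    ∀ᶠ N : ℕ in atTop, ENNReal.ofReal ((N : ℝ) ^ d) ≤ detectionDelay N μ (p N) (T N) := by
  have hδ0 : 0 < δ := hd0.trans hdδ
  have he1 := tendsto_mul_exp_neg_rpow 2 (show (0 : ℝ) < 1 / 4 by norm_num) hζ0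
  have he2 := tendsto_exp_neg_rpow (C := 2 * Real.exp (μ ^ 2)) (show (0 : ℝ) < 1 / 4 by norm_num)
    (show 0 < ζ - δ by linarith) (show 1 - β < ζ - δ by linarith)
  have he := he1.add he2
  rw [add_zero] at he
  have hgrow : Tendsto (fun N : ℕ => (N : ℝ) ^ (δ - d)) atTop atTop :=
    (tendsto_rpow_atTop (sub_pos.2 hdδ)).comp tendsto_natCast_atTop_atTop
  filter_upwards [he.eventually_lt_const one_half_pos,
    eventually_le_two_mul hpN (eventually_rpow_pos _),
    eventually_half_mul_le hγN (eventually_rpow_pos _), eventually_ge_atTop 2,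
    hgrow.eventually_ge_atTop 4] with N hN hpN' hγN' hN2 hgN
  have hN1 : (1 : ℝ) ≤ N := by exact_mod_cast (by omega : 1 ≤ N)
  have hN0 : (0 : ℝ) < N := by linarith
  have hNδ : 1 ≤ (N : ℝ) ^ δ := Real.one_le_rpow hN1 hδ0.le
  set k : ℕ := ⌊(N : ℝ) ^ δ⌋₊ with hk
  have hk1 : 1 ≤ k := Nat.le_floor (by simpa using hNδ)
  have hk1' : (1 : ℝ) ≤ k := by exact_mod_cast hk1
  have hk0 : (0 : ℝ) < k := by linarith
  have hkle : (k : ℝ) ≤ (N : ℝ) ^ δ := Nat.floor_le (by linarith)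
  have hkge : (N : ℝ) ^ δ < k + 1 := Nat.lt_floor_add_one _
  obtain ⟨hp0, hp1⟩ := hp N (by omega)
  -- The order s = 1/k keeps k s(1+s)μ²/2 at most μ², whatever the window length.
  have hs1 : 1 / (k : ℝ) ≤ 1 := (div_le_one hk0).2 hk1'
  have hs0 : 0 < 1 / (k : ℝ) := by positivity
  refine le_trans (ENNReal.ofReal_le_ofReal ?_) (le_detectionDelay_of_log hp0 hp1.le
    (zero_lt_one.trans_le (hγ N (by omega))) hs0 hs1 (hT N (by omega)) (hARL N (by omega)) hk1
    hγN' (e₁ := 2 * N * Real.exp (-(1 / 4 * (N : ℝ) ^ ζ)))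
    (e₂ := Real.exp (-(1 / 4 * (N : ℝ) ^ (ζ - δ)) + 2 * Real.exp (μ ^ 2) * (N : ℝ) ^ (1 - β)))
    ?_ ?_)
  -- From k ≥ 1 and k + 1 > N^δ follows k > N^δ/2. The error is below 1/2, so the bound exceeds
  -- N^δ/4, which is at least N^d because N^{δ-d} ≥ 4.
  · have h1 : (N : ℝ) ^ δ = (N : ℝ) ^ d * (N : ℝ) ^ (δ - d) := by
      rw [← Real.rpow_add hN0]; congr 1; ring
    have h2 : 0 < (N : ℝ) ^ d := Real.rpow_pos_of_pos hN0 d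
    nlinarith
  · refine mul_le_mul_of_nonneg_right (mul_le_mul_of_nonneg_left ?_ zero_le_two)
      (Real.exp_pos _).le
    calc (k : ℝ) ≤ (N : ℝ) ^ δ := hkle
      _ ≤ (N : ℝ) ^ (1 : ℝ) := Real.rpow_le_rpow_of_exponent_le hN1 (by linarith)
      _ = N := Real.rpow_one _
  · refine Real.exp_le_exp.2 (add_le_add ?_ ?_)
    · rw [neg_le_neg_iff, Real.rpow_sub hN0, div_mul_div_comm, div_mul_div_comm, one_mul,
        mul_comm 4]
      have := Real.rpow_pos_of_pos hN0 ζ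
      gcongr
    · have hpow : p N ^ (1 + 1 / (k : ℝ)) ≤ 2 * (N : ℝ) ^ (-β) := by
        refine le_trans ?_ hpN'
        nth_rewrite 2 [← Real.rpow_one (p N)]
        exact Real.rpow_le_rpow_of_exponent_ge hp0 hp1.le (by linarith)
      have hexp : (k : ℝ) * (1 / k * (1 + 1 / k) * μ ^ 2 / 2) ≤ μ ^ 2 := by
        have : (k : ℝ) * (1 / k * (1 + 1 / k) * μ ^ 2 / 2) = (1 + 1 / k) / 2 * μ ^ 2 := by
          field_simp
        rw [this]
        exact mul_le_of_le_one_left (sq_nonneg μ) (by linarith)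
      calc (N : ℝ) * (p N ^ (1 + 1 / (k : ℝ)) * Real.exp (k * (1 / k * (1 + 1 / k) * μ ^ 2 / 2)))
          ≤ N * (2 * (N : ℝ) ^ (-β) * Real.exp (μ ^ 2)) := by gcongr
        _ = 2 * Real.exp (μ ^ 2) * (N : ℝ) ^ (1 - β) := by
          rw [sub_eq_add_neg, Real.rpow_add hN0, Real.rpow_one]
          ring

end MultiStream
-- Passage to the lower limits
theorem theorem1
    (μ β ζ : ℝ) (hμ : 0 < μ) (hζ0 : 0 < ζ) (hζ1 : ζ < 1) (hβ0 : 0 < β) (hβ1 : β < 1)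
    (p γ : ℕ → ℝ)
    (hp : ∀ N : ℕ, 1 ≤ N → 0 < p N ∧ p N < 1)
    (hγ : ∀ N : ℕ, 1 ≤ N → 1 ≤ γ N)
    (hpN : p ~[atTop] fun N : ℕ => (N : ℝ) ^ (-β))
    (hγN : (fun N : ℕ => Real.log (γ N)) ~[atTop] fun N : ℕ => (N : ℝ) ^ ζ)
    (T : (N : ℕ) → MultiStream.Sample N → ℕ∞)
    (hT : ∀ N : ℕ, 1 ≤ N → IsStoppingTime (MultiStream.observed N) (T N))
    (hARL : ∀ N : ℕ, 1 ≤ N → ENNReal.ofReal (γ N) ≤ MultiStream.arl N μ (p N) (T N)) :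
    ((1 - ζ) / 2 < β → β < 1 - ζ →
      ((2 / μ ^ 2 * MultiStream.rho β ζ : ℝ) : EReal) ≤
        liminf (fun N : ℕ =>
          ((MultiStream.detectionDelay N μ (p N) (T N) : ℝ≥0∞) : EReal) /
            ((Real.log (N : ℝ) : ℝ) : EReal)) atTop) ∧
    (1 - ζ < β →
      ((β + ζ - 1 : ℝ) : EReal) ≤
        liminf (fun N : ℕ =>
          ENNReal.log (MultiStream.detectionDelay N μ (p N) (T N)) /
            ((Real.log (N : ℝ) : ℝ) : EReal)) atTop) := by

  refine ⟨fun h1 h2 => ?_, fun h1 => ?_⟩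
  · refine le_of_forall_lt fun a ha => ?_
    have hρ : (0 : ℝ) < 2 / μ ^ 2 * MultiStream.rho β ζ :=
      mul_pos (by positivity) (MultiStream.rho_pos h1 h2)
    -- Taking the maximum with 0 keeps `c` positive, as the growth bound requires, even when `a` is
    -- negative or -∞.
    obtain ⟨c, hac, hc⟩ := EReal.lt_iff_exists_real_btwn.1
      (max_lt ha (EReal.coe_lt_coe_iff.2 hρ))
    obtain ⟨hac, hc0⟩ := max_lt_iff.1 hac
    obtain ⟨c', hcc', hc'⟩ := exists_between (EReal.coe_lt_coe_iff.1 hc)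
    refine hac.trans_le (le_liminf_of_le (by isBoundedDefault) ?_)
    filter_upwards [MultiStream.eventually_mul_log_le_detectionDelay hμ hζ0 hp hγ hpN hγN hT hARL
      h2 (EReal.coe_pos.1 hc0) hcc' hc', eventually_ge_atTop 2] with N hN hN2
    have hL : 0 < Real.log N := Real.log_pos (by exact_mod_cast (by omega : 1 < N))
    rw [EReal.le_div_iff_mul_le (EReal.coe_pos.2 hL) (EReal.coe_ne_top _), ← EReal.coe_mul]
    refine le_trans ?_ (EReal.coe_ennreal_le_coe_ennreal_iff.2 hN)
    rw [EReal.coe_ennreal_ofReal]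
    exact EReal.coe_le_coe_iff.2 (le_max_left _ _)
  · refine le_of_forall_lt fun a ha => ?_
    have hpos : (0 : ℝ) < β + ζ - 1 := by linarith
    obtain ⟨d, had, hd⟩ := EReal.lt_iff_exists_real_btwn.1
      (max_lt ha (EReal.coe_lt_coe_iff.2 hpos))
    obtain ⟨had, hd0⟩ := max_lt_iff.1 had
    obtain ⟨δ, hdδ, hδ⟩ := exists_between (EReal.coe_lt_coe_iff.1 hd)
    refine had.trans_le (le_liminf_of_le (by isBoundedDefault) ?_)
    filter_upwards [MultiStream.eventually_rpow_le_detectionDelay hζ0 hζ1 hβ1 hp hγ hpN hγN hT hARL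
      (EReal.coe_pos.1 hd0) hdδ hδ, eventually_ge_atTop 2] with N hN hN2
    have hN0 : (0 : ℝ) < N := by exact_mod_cast (by omega : 0 < N)
    have hL : 0 < Real.log N := Real.log_pos (by exact_mod_cast (by omega : 1 < N))
    rw [EReal.le_div_iff_mul_le (EReal.coe_pos.2 hL) (EReal.coe_ne_top _), ← EReal.coe_mul]
    refine le_trans (le_of_eq ?_) (ENNReal.log_monotone hN)
    rw [ENNReal.log_ofReal_of_pos (Real.rpow_pos_of_pos hN0 d), Real.log_rpow hN0]
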